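/- Let $(X,d)$ be a complete metric space with a Borel regular outer measure $\mu$ that is doubling, i.e. $0<\mu(B(x,2r))\le C_d\,\mu(B(x,r))<\infty$ for all $x\in X$, $r>0$, and suppose that $X$ supports a $(1,1)$-Poincaré inequality: there are $C_P>0$, $\lambda\ge 1$ such that $$\frac1{\mu(B(x,r))}\int_{B(x,r)}|u-u_{B(x,r)}|\,d\mu\le C_P\,r\,\frac1{\mu(B(x,\lambda r))}\int_{B(x,\lambda r)}g\,d\mu$$ for every ball $B(x,r)$, every locally integrable $u$ and every upper gradient $g$ of $u$, where $u_B:=\mu(B)^{-1}\int_B u\,d\mu$. (A Borel function $g\ge 0$ is an upper gradient of $u$ in an open set $\Omega$ if $|u(x)-u(y)|\le\int_\gamma g\,ds$ for every rectifiable curve $\gamma$ in $\Omega$ with end points $x,y$.) For $A\subset X$ let $$\mathcal H(A):=\lim_{\delta\to0}\inf\Big\{\sum_i\frac{\mu(B(x_i,r_i))}{r_i}:\ A\subset\bigcup_i B(x_i,r_i),\ 0<r_i\le \delta\Big\},$$ with the infimum over countable covers, be the codimension $1$ Hausdorff measure. Let $\Omega\subset X$ be an arbitrary open set, let $R>0$,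 and let $u\in\mathrm{BV}(\Omega)$, that is, $u\in L^1(\Omega)$ and $$\|Du\|(\Omega):=\inf\Big\{\liminf_{i\to\infty}\int_\Omega g_{u_i}\,d\mu:\ u_i\in\mathrm{Lip}_{\mathrm{loc}}(\Omega),\ u_i\to u\text{ in }L^1_{\mathrm{loc}}(\Omega)\Big\}<\infty,$$ where each $g_{u_i}$ is an upper gradient of $u_i$ in $\Omega$, and "loc" refers to open sets $\Omega'$ whose closure is a compact subset of $\Omega$. Let $\{B_j=B(x_j,r_j)\}_j$ be a countable Whitney type covering of $\Omega$ at scale $R$: $x_j\in\Omega$, $\Omega=\bigcup_jB_j$, and 1. $r_j=\min\{\operatorname{dist}(x_j,X\setminus\Omega)/(20\lambda),R\}$ (with $\operatorname{dist}(x_j,\emptyset)=\infty$); 2. for some constant $C_0$, each ball $5\lambda B_k$ meets at most $C_0$ of the balls $5\lambda B_j$; 3. if $5\lambda B_j$ meets $5\lambda B_k$, then $r_j\le 2r_k$; 4. $\operatorname{dist}(2B_j,X\setminus\Omega)\ge 18\lambda r_j$. Let $\{\phi_j\}_j$ be a subordinate partition of unity: for some constant $C$, each $\phi_j$ is $C/r_j$-Lipschitz,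 $0\le\phi_j\le1$, $\phi_j=0$ outside $2B_j$, and $\sum_j\phi_j=1$ on $\Omega$. Let $u_W:=\sum_j u_{B_j}\phi_j$ be the corresponding discrete convolution of $u$. Then $$\lim_{r\to0^+}\frac1{\mu(B(x,r))}\int_{B(x,r)\cap\Omega}|u_W-u|\,d\mu=0\qquad\text{for }\mathcal H\text{-a.e. }x\in\partial\Omega.$$ -/

import Mathlib

open MeasureTheory Metric Set Filter Topology
open scoped NNReal ENNReal

noncomputable section

namespace MetricBV

variable {X : Type*} [MetricSpace X]

/-- The line integral `∫_γ g ds` of `g` along a rectifiable curve `γ : [a, b] → X`, defined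
through the arc-length parametrization of `γ` on `[0, length γ]`. -/
def lineIntegral (g : X → ℝ≥0∞) (γ : ℝ → X) (a b : ℝ) : ℝ≥0∞ :=
  ∫⁻ t in Icc 0 (eVariationOn γ (Icc a b)).toReal, g (naturalParameterization γ (Icc a b) a t)

/-- `γ : [a, b] → X` is a curve in `Ω`: a rectifiable continuous map from a compact interval
with values in `Ω`. -/
structure IsCurveIn (Ω : Set X) (γ : ℝ → X) (a b : ℝ) : Prop where
  le : a ≤ b
  continuousOn : ContinuousOn γ (Icc a b)
  rectifiable : eVariationOn γ (Icc a b) ≠ ∞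
  mapsTo : MapsTo γ (Icc a b) Ω

/-- `u ∈ Lip_loc(Ω)`: `u` is Lipschitz in every open `Ω'` whose closure is a compact subset
of `Ω`. -/
def IsLipLoc (Ω : Set X) (u : X → ℝ) : Prop :=
  ∀ Ω' : Set X, IsOpen Ω' → IsCompact (closure Ω') → closure Ω' ⊆ Ω →
    ∃ K : ℝ≥0, LipschitzOnWith K u Ω'

variable [MeasurableSpace X]

/-- The Borel function `g ≥ 0` is an upper gradient in `Ω` of the real-valued function `u`.
Only the values of `u` and `g` in `Ω` matter. -/
def IsUpperGradient (Ω : Set X) (u : X → ℝ) (g : X → ℝ≥0∞) : Prop :=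
  Measurable g ∧
    ∀ (γ : ℝ → X) (a b : ℝ), IsCurveIn Ω γ a b →
      ENNReal.ofReal |u (γ a) - u (γ b)| ≤ lineIntegral g γ a b

/-- Doubling: `0 < μ(B(x,2r)) ≤ C_d μ(B(x,r)) < ∞` for all balls. -/
def IsDoubling (μ : Measure X) (Cd : ℝ≥0) : Prop :=
  ∀ (x : X) (r : ℝ), 0 < r →
    0 < μ (ball x (2 * r)) ∧ μ (ball x (2 * r)) ≤ Cd * μ (ball x r) ∧ μ (ball x r) < ∞

/-- The `(1,1)`-Poincaré inequality with constants `C_P > 0` and `lam ≥ 1`. -/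
def SupportsPoincare (μ : Measure X) (CP lam : ℝ) : Prop :=
  0 < CP ∧ 1 ≤ lam ∧
    ∀ (x : X) (r : ℝ), 0 < r → ∀ (u : X → ℝ) (g : X → ℝ≥0∞),
      LocallyIntegrable u μ → IsUpperGradient univ u g →
        ⨍⁻ y in ball x r, ENNReal.ofReal |u y - ⨍ z in ball x r, u z ∂μ| ∂μ ≤
          ENNReal.ofReal (CP * r) * ⨍⁻ y in ball x (lam * r), g y ∂μ

/-- `v i → u` in `L¹_loc(Ω)`. -/
def TendstoL1Loc (μ : Measure X) (Ω : Set X) (v : ℕ → X → ℝ) (u : X → ℝ) : Prop :=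
  ∀ Ω' : Set X, IsOpen Ω' → IsCompact (closure Ω') → closure Ω' ⊆ Ω →
    Tendsto (fun i => ∫⁻ x in Ω', ENNReal.ofReal |v i x - u x| ∂μ) atTop (𝓝 0)

/-- The total variation `‖Du‖(Ω)`: the infimum of `liminf ∫_Ω g_i dμ` over all sequences
`v i ∈ Lip_loc(Ω)` converging to `u` in `L¹_loc(Ω)` and upper gradients `g i` of `v i` in `Ω`. -/
def totalVariation (μ : Measure X) (Ω : Set X) (u : X → ℝ) : ℝ≥0∞ :=
  ⨅ (v : ℕ → X → ℝ) (g : ℕ → X → ℝ≥0∞) (_ : ∀ i, IsLipLoc Ω (v i))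
    (_ : ∀ i, IsUpperGradient Ω (v i) (g i)) (_ : TendstoL1Loc μ Ω v u),
    liminf (fun i => ∫⁻ x in Ω, g i x ∂μ) atTop

/-- `u ∈ BV(Ω)`. Only the values of `u` in `Ω` matter. -/
def IsBV (μ : Measure X) (Ω : Set X) (u : X → ℝ) : Prop :=
  IntegrableOn u Ω μ ∧ totalVariation μ Ω u < ∞

/-- The restricted spherical Hausdorff content of codimension `1`; the infimum is over
(finite or infinite) countable covers by balls of radius at most `R`. -/
def hausdorffContent (μ : Measure X) (R : ℝ) (A : Set X) : ℝ≥0∞ :=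
  ⨅ (S : Set (X × ℝ)) (_ : S.Countable) (_ : ∀ p ∈ S, 0 < p.2 ∧ p.2 ≤ R)
    (_ : A ⊆ ⋃ p ∈ S, ball p.1 p.2),
    ∑' p : S, μ (ball p.1.1 p.1.2) / ENNReal.ofReal p.1.2

/-- The codimension `1` Hausdorff measure. The content is monotone in `R`, so the limit as
`R → 0` is the supremum over `R > 0`. -/
def hausdorffCodimOne (μ : Measure X) (A : Set X) : ℝ≥0∞ :=
  ⨆ (R : ℝ) (_ : 0 < R), hausdorffContent μ R A

/-- The balls `B_j = B(c j, r j)` form a Whitney type covering of `Ω` at scale `R`, with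
dilation constant `lam` and overlap constant `C0`. The distance to `X \ Ω` is the extended one,
so that it is `∞` if `Ω = X`. -/
structure IsWhitneyCovering {ι : Type*} (Ω : Set X) (lam R : ℝ) (C0 : ℕ)
    (c : ι → X) (r : ι → ℝ) : Prop where
  center_mem : ∀ j, c j ∈ Ω
  radius_pos : ∀ j, 0 < r j
  iUnion_eq : ⋃ j, ball (c j) (r j) = Ω
  radius_eq : ∀ j, ENNReal.ofReal (r j) =
    min (infEDist (c j) Ωᶜ / ENNReal.ofReal (20 * lam)) (ENNReal.ofReal R)
  overlap : ∀ k,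
    {j | (ball (c j) (5 * lam * r j) ∩ ball (c k) (5 * lam * r k)).Nonempty}.encard ≤ C0
  radius_le : ∀ j k, (ball (c j) (5 * lam * r j) ∩ ball (c k) (5 * lam * r k)).Nonempty →
    r j ≤ 2 * r k
  le_dist : ∀ j, ∀ y ∈ ball (c j) (2 * r j), ∀ z ∈ Ωᶜ, 18 * lam * r j ≤ dist y z

/-- `φ` is a partition of unity in `Ω` subordinate to the covering by the balls
`B_j = B(c j, r j)`: each `φ j` is `L / r j`-Lipschitz, vanishes outside `2 B_j`, has values in
`[0, 1]`, and `∑ φ j = 1` in `Ω`. -/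
structure IsWhitneyPartition {ι : Type*} (Ω : Set X) (c : ι → X) (r : ι → ℝ) (L : ℝ≥0)
    (φ : ι → X → ℝ) : Prop where
  lipschitz : ∀ j, LipschitzWith (L / (r j).toNNReal) (φ j)
  support_subset : ∀ j, Function.support (φ j) ⊆ ball (c j) (2 * r j)
  nonneg : ∀ j x, 0 ≤ φ j x
  le_one : ∀ j x, φ j x ≤ 1
  hasSum_one : ∀ x ∈ Ω, HasSum (fun j => φ j x) 1

/-- The discrete convolution `u_W = ∑ u_{B_j} φ_j`. -/
def discreteConvolution {ι : Type*} (μ : Measure X) (c : ι → X) (r : ι → ℝ)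
    (φ : ι → X → ℝ) (u : X → ℝ) : X → ℝ :=
  fun x => ∑' j, (⨍ y in ball (c j) (r j), u y ∂μ) * φ j x

end MetricBV

end

/-! The variation of `u` is replaced by a discrete measure. Since `‖Du‖(Ω)` is finite, some sequence
`v i → u` with upper gradients `g i` has finite `liminf ∫_Ω g i`; no minimality is needed. Put `a k
= liminf ∫_{2λB_k} g i` and place mass `a k` at the centre `c k`. By Fatou for sums and bounded
overlap this measure `ν` is finite, and it is carried by `Ω`.

As `∑ φ_k = 1`, `|u_W - u|` is at most the sum over `k` of `|u - u_{B_k}|` on `2B_k`, and the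
Poincaré inequality bounds the integral of each term by `K r_k a_k`. If `x ∉ Ω` and `2B_k` meets
`B(x,s)`, the Whitney separation forces `r_k ≤ s` and `c k ∈ B(x,2s)`. Hence `∫_{B(x,s) ∩ Ω} |u_W -
u| ≤ K s ν(B(x,2s))`.

It remains that `s ν(B(x,2s)) / μ(B(x,s)) → 0` for almost every `x ∉ Ω`. All but a small part of `ν`
sits at finitely many points of the open set `Ω`, invisible from its complement at small scales; a
Vitali covering argument bounds the exceptional set by the remaining mass. -/

noncomputable section

/-! ### Rectifiable curves and extension of upper gradients -/

namespace MetricBV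

variable {X : Type*} [MetricSpace X]

/-- The length function of a continuous curve of bounded variation is continuous. -/
theorem continuousOn_variationOnFromTo {γ : ℝ → X} {a b : ℝ} (hab : a ≤ b)
    (hc : ContinuousOn γ (Icc a b)) (hγ : BoundedVariationOn γ (Icc a b)) :
    ContinuousOn (variationOnFromTo γ (Icc a b) a) (Icc a b) := by
  intro t ht
  -- The one-sided limits differ from the value at `t` by the jumps of `γ`, which vanish by
  -- continuity.
  have hl := variationOnFromTo.tendsto_left (left_mem_Icc.2 hab) ht hγ.locallyBoundedVariationOn
    ((hc t ht).mono_left (nhdsWithin_mono t inter_subset_left))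
  have hr := variationOnFromTo.tendsto_right (left_mem_Icc.2 hab) ht hγ.locallyBoundedVariationOn
    ((hc t ht).mono_left (nhdsWithin_mono t inter_subset_left))
  rw [dist_self, sub_zero] at hl
  rw [dist_self, add_zero] at hr
  have hl' : ContinuousWithinAt (variationOnFromTo γ (Icc a b) a) (Icc a b ∩ Iio t) t := hl
  have hr' : ContinuousWithinAt (variationOnFromTo γ (Icc a b) a) (Icc a b ∩ Ioi t) t := hr
  have h := ((hl'.union hr').union (continuousWithinAt_singleton (x := t)))
  refine h.mono fun y hy => ?_
  rcases lt_trichotomy y t with h | h | h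
  · exact Or.inl (Or.inl ⟨hy, h⟩)
  · exact Or.inr h
  · exact Or.inl (Or.inr ⟨hy, h⟩)

/-- Unit speed of the natural parametrization is known only on the range of the length function. By
the intermediate value theorem this range contains the whole interval used in `lineIntegral`. -/
theorem Icc_subset_image_variationOnFromTo {γ : ℝ → X} {a b : ℝ} (hab : a ≤ b)
    (hc : ContinuousOn γ (Icc a b)) (hγ : BoundedVariationOn γ (Icc a b)) :
    Icc 0 (eVariationOn γ (Icc a b)).toReal ⊆ variationOnFromTo γ (Icc a b) a '' Icc a b := by
  have h := intermediate_value_Icc hab (continuousOn_variationOnFromTo hab hc hγ)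
  rwa [variationOnFromTo.self, variationOnFromTo.eq_of_le _ _ hab, inter_self] at h

/-- The arc-length parametrization of a rectifiable curve is `1`-Lipschitz. -/
theorem dist_naturalParameterization_le {γ : ℝ → X} {a b : ℝ} (hab : a ≤ b)
    (hc : ContinuousOn γ (Icc a b)) (hγ : BoundedVariationOn γ (Icc a b)) {s t : ℝ}
    (hs : s ∈ Icc 0 (eVariationOn γ (Icc a b)).toReal)
    (ht : t ∈ Icc 0 (eVariationOn γ (Icc a b)).toReal) :
    dist (naturalParameterization γ (Icc a b) a s) (naturalParameterization γ (Icc a b) a t) ≤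
      |s - t| := by
  wlog hst : s ≤ t generalizing s t
  · rw [dist_comm, abs_sub_comm]
    exact this ht hs (le_of_not_ge hst)
  have hs' := Icc_subset_image_variationOnFromTo hab hc hγ hs
  have ht' := Icc_subset_image_variationOnFromTo hab hc hγ ht
  have h := has_unit_speed_naturalParameterization γ hγ.locallyBoundedVariationOn
    (left_mem_Icc.2 hab) hs' ht'
  have h' := eVariationOn.edist_le (naturalParameterization γ (Icc a b) a)
    (s := variationOnFromTo γ (Icc a b) a '' Icc a b ∩ Icc s t)
    ⟨hs', left_mem_Icc.2 hst⟩ ⟨ht', right_mem_Icc.2 hst⟩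
  rw [h, edist_dist, NNReal.coe_one, one_mul] at h'
  rw [abs_sub_comm, abs_of_nonneg (sub_nonneg.2 hst)]
  exact (ENNReal.ofReal_le_ofReal_iff (sub_nonneg.2 hst)).1 h'

/-- A nonconstant rectifiable curve which leaves a closed set `F` spends a positive length
outside `F`. -/
theorem lineIntegral_eq_top_of_exists_notMem {γ : ℝ → X} {a b : ℝ} {Ω F : Set X}
    (hγ : IsCurveIn Ω γ a b) (hF : IsClosed F) {g : X → ℝ≥0∞} (hg : ∀ y ∉ F, g y = ∞)
    (hne : γ a ≠ γ b) {t : ℝ} (ht : t ∈ Icc a b) (htF : γ t ∉ F) :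
    lineIntegral g γ a b = ∞ := by
  have hbv : BoundedVariationOn γ (Icc a b) := hγ.rectifiable
  set ℓ := (eVariationOn γ (Icc a b)).toReal with hℓ
  have hpos : 0 < ℓ := by
    refine (dist_pos.2 hne).trans_le ?_
    exact hbv.dist_le (left_mem_Icc.2 hγ.le) (right_mem_Icc.2 hγ.le)
  set s := variationOnFromTo γ (Icc a b) a t with hs
  have hs0 : 0 ≤ s := variationOnFromTo.nonneg_of_le _ _ ht.1
  have hsl : s ≤ ℓ := (le_abs_self _).trans (variationOnFromTo.abs_le_eVariationOn hbv)
  have hst : naturalParameterization γ (Icc a b) a s = γ t :=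
    edist_eq_zero.1 (edist_naturalParameterization_eq_zero hbv.locallyBoundedVariationOn
      (left_mem_Icc.2 hγ.le) ht)
  obtain ⟨η, hη, hball⟩ := Metric.isOpen_iff.1 hF.isOpen_compl (γ t) htF
  -- On this window the arc-length parametrization stays within `η / 2` of `γ t`, hence outside `F`.
  -- Truncation to `[0, ℓ]` leaves positive length because `ℓ > 0`.
  have hvol : 0 < volume (Icc (max 0 (s - η / 2)) (min ℓ (s + η / 2))) := by
    rw [Real.volume_Icc, ENNReal.ofReal_pos, sub_pos]
    refine max_lt (lt_min hpos ?_) (lt_min ?_ ?_) <;> linarith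
  rw [lineIntegral, eq_top_iff]
  calc (∞ : ℝ≥0∞) = ∫⁻ _ in Icc (max 0 (s - η / 2)) (min ℓ (s + η / 2)), (∞ : ℝ≥0∞) := by
        rw [lintegral_const, Measure.restrict_apply_univ, ENNReal.top_mul hvol.ne']
    _ ≤ ∫⁻ r in Icc (max 0 (s - η / 2)) (min ℓ (s + η / 2)),
          g (naturalParameterization γ (Icc a b) a r) := by
        refine setLIntegral_mono' measurableSet_Icc fun r hr => ?_
        obtain ⟨h1, h2⟩ := hr
        obtain ⟨h3, h4⟩ := max_le_iff.1 h1
        obtain ⟨h5, h6⟩ := le_min_iff.1 h2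
        have hd := dist_naturalParameterization_le hγ.le hγ.continuousOn hbv
          (s := r) (t := s) ⟨h3, h5⟩ ⟨hs0, hsl⟩
        rw [hst] at hd
        rw [hg]
        refine hball (mem_ball.2 (hd.trans_lt ?_))
        rw [abs_lt]
        constructor <;> linarith
    _ ≤ _ := lintegral_mono_set (Icc_subset_Icc (le_max_left _ _) (min_le_left _ _))

/-- If `F ⊆ Ω` is closed, an upper gradient in `Ω` of `v` yields an upper gradient in the whole
space of the zero extension of `v` from `F`: it suffices to add `∞` outside `F`. -/
theorem IsUpperGradient.indicator [MeasurableSpace X] [BorelSpace X] {Ω F : Set X} {v : X → ℝ}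
    {g : X → ℝ≥0∞} (hg : IsUpperGradient Ω v g) (hF : IsClosed F) (hFΩ : F ⊆ Ω) :
    IsUpperGradient univ (F.indicator v) (fun y => g y + Fᶜ.indicator (fun _ => ∞) y) := by
  refine ⟨hg.1.add (measurable_const.indicator hF.measurableSet.compl), fun γ a b hγ => ?_⟩
  by_cases hγF : MapsTo γ (Icc a b) F
  · rw [indicator_of_mem (hγF (left_mem_Icc.2 hγ.le)),
      indicator_of_mem (hγF (right_mem_Icc.2 hγ.le))]
    refine (hg.2 γ a b ⟨hγ.le, hγ.continuousOn, hγ.rectifiable, hγF.mono_right hFΩ⟩).trans ?_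
    exact lintegral_mono fun t => le_self_add
  -- A constant curve outside `F` has zero line integral even for the weight `∞`; for equal end
  -- points the left side vanishes instead.
  · by_cases hne : γ a = γ b
    · simp [hne]
    · simp only [MapsTo, not_forall] at hγF
      obtain ⟨t, ht, htF⟩ := hγF
      rw [lineIntegral_eq_top_of_exists_notMem hγ hF (fun y hy => ?_) hne ht htF]
      · exact le_top
      · simp [hy]

end MetricBV

/-! ### Doubling measures and properness -/

namespace MetricBV

theorem IsLipLoc.continuousOn_of_isCompact {X : Type*} [MetricSpace X] [LocallyCompactSpace X]
    {Ω F : Set X} {v : X → ℝ} (hv : IsLipLoc Ω v) (hΩ : IsOpen Ω) (hF : IsCompact F) (hFΩ : F ⊆ Ω) :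
    ContinuousOn v F := by
  obtain ⟨V, hV, hFV, hVΩ, hVc⟩ := exists_open_between_and_isCompact_closure hF hΩ hFΩ
  obtain ⟨K, hK⟩ := hv V hV hVc hVΩ
  exact hK.continuousOn.mono hFV

theorem measure_mul_abs_average_sub_le {X : Type*} [MeasurableSpace X] {μ : Measure X}
    {A : Set X} {u : X → ℝ} (hu : IntegrableOn u A μ)
    (h0 : μ A ≠ 0) (ht : μ A ≠ ∞) (k : ℝ) :
    μ A * ENNReal.ofReal |(⨍ y in A, u y ∂μ) - k| ≤ ∫⁻ y in A, ENNReal.ofReal |u y - k| ∂μ := by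
  have : IsFiniteMeasure (μ.restrict A) := ⟨by rw [Measure.restrict_apply_univ]; exact ht.lt_top⟩
  have havg : (⨍ y in A, u y ∂μ) - k = ⨍ y in A, (u y - k) ∂μ := by
    rw [setAverage_eq, setAverage_eq, integral_sub hu (integrable_const k), integral_const,
      smul_sub, smul_smul]
    have hne : μ.real A ≠ 0 := (ENNReal.toReal_ne_zero.2 ⟨h0, ht⟩)
    rw [measureReal_restrict_apply_univ, inv_mul_cancel₀ hne, one_smul]
  simp only [← Real.enorm_eq_ofReal_abs]
  rw [havg, average, Measure.restrict_apply_univ]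
  calc μ A * ‖∫ y, (u y - k) ∂((μ A)⁻¹ • μ.restrict A)‖ₑ
      ≤ μ A * ∫⁻ y, ‖u y - k‖ₑ ∂((μ A)⁻¹ • μ.restrict A) := by
        gcongr
        exact enorm_integral_le_lintegral_enorm _
    _ = _ := by
        rw [lintegral_smul_measure, smul_eq_mul, ← mul_assoc, ENNReal.mul_inv_cancel h0 ht, one_mul]

variable {X : Type*} [MetricSpace X] [MeasurableSpace X] {μ : Measure X} {Cd : ℝ≥0}

theorem IsDoubling.measure_ball_pos (hμ : IsDoubling μ Cd) (x : X) {r : ℝ} (hr : 0 < r) :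
    0 < μ (ball x r) := by
  have h := (hμ x (r / 2) (half_pos hr)).1
  rwa [mul_div_cancel₀ r two_ne_zero] at h

theorem IsDoubling.measure_ball_lt_top (hμ : IsDoubling μ Cd) (x : X) (r : ℝ) :
    μ (ball x r) < ∞ := by
  rcases le_or_gt r 0 with hr | hr
  · simp [ball_eq_empty.2 hr]
  · exact (hμ x r hr).2.2

theorem IsDoubling.measure_ball_two_pow_le (hμ : IsDoubling μ Cd) (x : X) {r : ℝ} (hr : 0 < r)
    (n : ℕ) : μ (ball x (2 ^ n * r)) ≤ (Cd : ℝ≥0∞) ^ n * μ (ball x r) := by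
  induction n with
  | zero => simp
  | succ n ih =>
    calc μ (ball x (2 ^ (n + 1) * r)) = μ (ball x (2 * (2 ^ n * r))) := by
          rw [pow_succ', mul_assoc]
      _ ≤ Cd * μ (ball x (2 ^ n * r)) := (hμ x _ (by positivity)).2.1
      _ ≤ Cd * ((Cd : ℝ≥0∞) ^ n * μ (ball x r)) := by gcongr
      _ = _ := by rw [pow_succ', mul_assoc]

theorem IsDoubling.isLocallyFiniteMeasure (hμ : IsDoubling μ Cd) : IsLocallyFiniteMeasure μ :=
  ⟨fun x => ⟨ball x 1, ball_mem_nhds x one_pos, hμ.measure_ball_lt_top x 1⟩⟩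

/-- Volume packing: disjoint balls of a common radius `ρ ≤ r` centred in `B(x,r)` lie in `B(x,2r)`,
and each carries at least a fixed fraction of `μ(B(x,r))`, so there are finitely many. In Vitali's
lemma the cap `ρ ≤ ε / 4` makes the 4-fold enlargements fit in `ε`-balls. -/
theorem IsDoubling.totallyBounded_ball [BorelSpace X] (hμ : IsDoubling μ Cd) (x : X) {r : ℝ}
    (hr : 0 < r) : TotallyBounded (ball x r) := by
  rw [Metric.totallyBounded_iff]
  intro ε hε
  obtain ⟨T, hT, hdisj, hcov⟩ := Vitali.exists_disjoint_subfamily_covering_enlargement_ball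
    (ball x r) (fun y : X => y) (fun _ => min r (ε / 4)) (ε / 4) (fun _ _ => min_le_right _ _) 4
    (by norm_num)
  set ρ := min r (ε / 4) with hρ
  have hρ0 : 0 < ρ := lt_min hr (by positivity)
  refine ⟨T, ?_, fun y hy => ?_⟩
  -- With `2 ^ n * ρ > 2 * r`, the enlarged ball around any `y ∈ B(x,r)` contains `B(x,r)`.
  · obtain ⟨n, hn⟩ := pow_unbounded_of_one_lt (2 * r / ρ) (one_lt_two : (1 : ℝ) < 2)
    rw [div_lt_iff₀ hρ0] at hn
    have hlow : ∀ y ∈ T, μ (ball x r) / (Cd : ℝ≥0∞) ^ n ≤ μ (ball y ρ) := fun y hy => by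
      refine ENNReal.div_le_of_le_mul' (le_trans (measure_mono fun z hz => ?_)
        (hμ.measure_ball_two_pow_le y hρ0 n))
      have h1 : dist y x < r := hT hy
      have h2 : dist z x < r := hz
      have := dist_triangle_right z y x
      exact mem_ball.2 (by linarith)
    have hpos : 0 < μ (ball x r) / (Cd : ℝ≥0∞) ^ n :=
      ENNReal.div_pos (hμ.measure_ball_pos x hr).ne' (by finiteness)
    have hfin := Measure.finite_const_le_meas_of_disjoint_iUnion μ hpos
      (As := fun y : T => ball (y : X) ρ) (fun _ => measurableSet_ball)
      (fun y z hyz => hdisj y.2 z.2 (fun h => hyz (Subtype.ext h)))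
      (ne_top_of_le_ne_top (hμ.measure_ball_lt_top x (2 * r)).ne (measure_mono (by
        refine iUnion_subset fun y z hz => ?_
        have h1 : dist (y : X) x < r := hT y.2
        have h2 : dist z y < ρ := hz
        have := dist_triangle z y x
        have := min_le_left r (ε / 4)
        exact mem_ball.2 (by linarith))))
    have huniv : {i : T | μ (ball x r) / (Cd : ℝ≥0∞) ^ n ≤ μ (ball (i : X) ρ)} = univ :=
      eq_univ_of_forall fun i => hlow i i.2
    rw [huniv, finite_univ_iff] at hfin
    exact toFinite T
  · obtain ⟨z, hz, hsub⟩ := hcov y hy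
    refine mem_iUnion₂.2 ⟨z, hz, ?_⟩
    refine ball_subset_ball ?_ (hsub (mem_ball_self hρ0))
    have := min_le_right r (ε / 4)
    linarith

/-- A complete metric space with a doubling measure is proper. -/
theorem IsDoubling.properSpace [BorelSpace X] [CompleteSpace X] (hμ : IsDoubling μ Cd) :
    ProperSpace X := by
  refine ⟨fun x r => ?_⟩
  refine TotallyBounded.isCompact_of_isClosed ?_ isClosed_closedBall
  refine (hμ.totallyBounded_ball x (r := max r 0 + 1) (by positivity)).subset ?_
  exact closedBall_subset_ball (by linarith [le_max_left r 0])

/-! ### Local Poincaré inequalities -/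

/-- The Poincaré inequality for locally Lipschitz functions defined only in a neighborhood of
the ball. -/
theorem SupportsPoincare.lintegral_abs_sub_average_le [BorelSpace X] [ProperSpace X]
    (hμ : IsDoubling μ Cd) {CP lam : ℝ} (hP : SupportsPoincare μ CP lam) {Ω : Set X}
    (hΩ : IsOpen Ω) {v : X → ℝ} {g : X → ℝ≥0∞} (hv : IsLipLoc Ω v) (hg : IsUpperGradient Ω v g)
    {x : X} {r : ℝ} (hr : 0 < r) (hball : closedBall x (lam * r) ⊆ Ω) :
    ∫⁻ y in ball x r, ENNReal.ofReal |v y - ⨍ z in ball x r, v z ∂μ| ∂μ ≤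
      ENNReal.ofReal (CP * r) * ∫⁻ y in ball x (lam * r), g y ∂μ := by
  have := hμ.isLocallyFiniteMeasure
  obtain ⟨hCP, hlam, hP⟩ := hP
  -- The compact set `F ⊆ Ω` makes the zero extension integrable, and the weight `∞` outside `F` is
  -- not seen by the average over the open ball.
  set F := closedBall x (lam * r) with hF
  have hrl : r ≤ lam * r := le_mul_of_one_le_left hr.le hlam
  have hBF : ball x r ⊆ F := (ball_subset_ball hrl).trans ball_subset_closedBall
  have hint : Integrable (F.indicator v) μ := by
    rw [integrable_indicator_iff isClosed_closedBall.measurableSet]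
    exact (hv.continuousOn_of_isCompact hΩ (isCompact_closedBall _ _) hball).integrableOn_compact
      (isCompact_closedBall _ _)
  have key := hP x r hr _ _ hint.locallyIntegrable (hg.indicator isClosed_closedBall hball)
  have havg : ⨍ z in ball x r, F.indicator v z ∂μ = ⨍ z in ball x r, v z ∂μ :=
    setAverage_congr_fun measurableSet_ball (.of_forall fun z hz => indicator_of_mem (hBF hz) v)
  rw [havg, setLAverage_eq, setLAverage_eq] at key
  have h1 : ∫⁻ y in ball x r, ENNReal.ofReal |F.indicator v y - ⨍ z in ball x r, v z ∂μ| ∂μ =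
      ∫⁻ y in ball x r, ENNReal.ofReal |v y - ⨍ z in ball x r, v z ∂μ| ∂μ :=
    setLIntegral_congr_fun measurableSet_ball fun y hy => by
      simp only [indicator_of_mem (hBF hy)]
  have h2 : ∫⁻ y in ball x (lam * r), (g y + Fᶜ.indicator (fun _ => ∞) y) ∂μ =
      ∫⁻ y in ball x (lam * r), g y ∂μ :=
    setLIntegral_congr_fun measurableSet_ball fun y hy => by
      have : y ∉ Fᶜ := fun h => h (ball_subset_closedBall hy)
      simp only [indicator_of_notMem this, add_zero]
  rw [h1, h2] at key
  have hB0 := (hμ.measure_ball_pos x hr).ne'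
  have hBt := (hμ.measure_ball_lt_top x r).ne
  rw [ENNReal.div_le_iff hB0 hBt, mul_assoc] at key
  refine key.trans ?_
  gcongr
  calc (∫⁻ y in ball x (lam * r), g y ∂μ) / μ (ball x (lam * r)) * μ (ball x r)
      ≤ (∫⁻ y in ball x (lam * r), g y ∂μ) / μ (ball x (lam * r)) * μ (ball x (lam * r)) := by
        gcongr
    _ ≤ _ := ENNReal.mul_le_of_le_div le_rfl

/-- The mean oscillation on `2B` around the average on `B` is comparable to the oscillation
around any constant. -/
theorem IsDoubling.lintegral_abs_sub_average_half_le [BorelSpace X] (hμ : IsDoubling μ Cd) {x : X}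
    {r : ℝ} (hr : 0 < r) {u : X → ℝ} (hu : IntegrableOn u (ball x (2 * r)) μ) (k : ℝ) :
    ∫⁻ y in ball x (2 * r), ENNReal.ofReal |u y - ⨍ z in ball x r, u z ∂μ| ∂μ ≤
      (1 + Cd) * ∫⁻ y in ball x (2 * r), ENNReal.ofReal |u y - k| ∂μ := by
  have hsub : ball x r ⊆ ball x (2 * r) := ball_subset_ball (by linarith)
  set m := ⨍ z in ball x r, u z ∂μ with hm
  calc ∫⁻ y in ball x (2 * r), ENNReal.ofReal |u y - m| ∂μ
      ≤ ∫⁻ y in ball x (2 * r), (ENNReal.ofReal |u y - k| + ENNReal.ofReal |m - k|) ∂μ := by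
        refine lintegral_mono fun y => ?_
        rw [← ENNReal.ofReal_add (abs_nonneg _) (abs_nonneg _), abs_sub_comm m k]
        exact ENNReal.ofReal_le_ofReal (abs_sub_le _ _ _)
    _ = (∫⁻ y in ball x (2 * r), ENNReal.ofReal |u y - k| ∂μ) +
          ENNReal.ofReal |m - k| * μ (ball x (2 * r)) := by
        rw [lintegral_add_right _ measurable_const, lintegral_const, Measure.restrict_apply_univ]
    _ ≤ (∫⁻ y in ball x (2 * r), ENNReal.ofReal |u y - k| ∂μ) +
          Cd * (μ (ball x r) * ENNReal.ofReal |m - k|) := by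
        rw [mul_comm (ENNReal.ofReal _), ← mul_assoc]
        gcongr
        exact (hμ x r hr).2.1
    _ ≤ (∫⁻ y in ball x (2 * r), ENNReal.ofReal |u y - k| ∂μ) +
          Cd * ∫⁻ y in ball x (2 * r), ENNReal.ofReal |u y - k| ∂μ := by
        gcongr
        exact (measure_mul_abs_average_sub_le (hu.mono_set hsub) (hμ.measure_ball_pos x hr).ne'
          (hμ.measure_ball_lt_top x r).ne k).trans (lintegral_mono_set hsub)
    _ = _ := by rw [add_mul, one_mul]

/-- The Poincaré inequality for a limit of locally Lipschitz functions. -/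
theorem SupportsPoincare.lintegral_abs_sub_average_half_le_liminf [BorelSpace X] [ProperSpace X]
    (hμ : IsDoubling μ Cd) {CP lam : ℝ} (hP : SupportsPoincare μ CP lam) {Ω : Set X}
    (hΩ : IsOpen Ω) {u : X → ℝ} (hu : IntegrableOn u Ω μ) {v : ℕ → X → ℝ} {g : ℕ → X → ℝ≥0∞}
    (hv : ∀ i, IsLipLoc Ω (v i)) (hg : ∀ i, IsUpperGradient Ω (v i) (g i))
    (hvu : TendstoL1Loc μ Ω v u) {x : X} {r : ℝ} (hr : 0 < r)
    (hball : closedBall x (lam * (2 * r)) ⊆ Ω) :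
    ∫⁻ y in ball x (2 * r), ENNReal.ofReal |u y - ⨍ z in ball x r, u z ∂μ| ∂μ ≤
      (1 + Cd) * (ENNReal.ofReal (CP * (2 * r)) *
        liminf (fun i => ∫⁻ y in ball x (lam * (2 * r)), g i y ∂μ) atTop) := by
  have hBc : closedBall x (2 * r) ⊆ Ω := (closedBall_subset_closedBall
    (le_mul_of_one_le_left (by positivity) hP.2.1)).trans hball
  have hB : ball x (2 * r) ⊆ Ω := ball_subset_closedBall.trans hBc
  have hconv := hvu (ball x (2 * r)) isOpen_ball
    ((isCompact_closedBall x (2 * r)).of_isClosed_subset isClosed_closure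
      closure_ball_subset_closedBall) (closure_ball_subset_closedBall.trans hBc)
  -- A subsequence turns the lower limit into a limit and keeps the `L¹` convergence.
  obtain ⟨ψ, hψ, hψ'⟩ := exists_seq_tendsto_liminf
    (u := fun i => ∫⁻ y in ball x (lam * (2 * r)), g i y ∂μ) (f := atTop)
  have hlim : Tendsto (fun n => (1 + (Cd : ℝ≥0∞)) *
      ((∫⁻ y in ball x (2 * r), ENNReal.ofReal |v (ψ n) y - u y| ∂μ) +
        ENNReal.ofReal (CP * (2 * r)) * ∫⁻ y in ball x (lam * (2 * r)), g (ψ n) y ∂μ)) atTop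
      (𝓝 ((1 + Cd) * (0 + ENNReal.ofReal (CP * (2 * r)) *
        liminf (fun i => ∫⁻ y in ball x (lam * (2 * r)), g i y ∂μ) atTop))) :=
    ENNReal.Tendsto.const_mul ((hconv.comp hψ').add
      (ENNReal.Tendsto.const_mul hψ (Or.inr ENNReal.ofReal_ne_top))) (Or.inr (by finiteness))
  rw [zero_add] at hlim
  refine ge_of_tendsto' hlim fun n => ?_
  set i := ψ n
  -- The comparison constant is the average of `v i` over `2B`, around which the Poincaré inequality
  -- controls `v i`.
  refine (hμ.lintegral_abs_sub_average_half_le hr (hu.mono_set hB)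
    (⨍ z in ball x (2 * r), v i z ∂μ)).trans ?_
  gcongr
  have hm : AEMeasurable (fun y => ENNReal.ofReal |v i y - u y|)
      (μ.restrict (ball x (2 * r))) := by
    have h1 : AEMeasurable (v i) (μ.restrict (ball x (2 * r))) :=
      (((hv i).continuousOn_of_isCompact hΩ (isCompact_closedBall x (2 * r)) hBc).mono
        ball_subset_closedBall).aemeasurable measurableSet_ball
    have h2 : AEMeasurable u (μ.restrict (ball x (2 * r))) := (hu.mono_set hB).aemeasurable
    simp only [← Real.enorm_eq_ofReal_abs]
    exact (h1.sub h2).enorm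
  calc ∫⁻ y in ball x (2 * r), ENNReal.ofReal |u y - ⨍ z in ball x (2 * r), v i z ∂μ| ∂μ
      ≤ ∫⁻ y in ball x (2 * r), (ENNReal.ofReal |v i y - u y| +
          ENNReal.ofReal |v i y - ⨍ z in ball x (2 * r), v i z ∂μ|) ∂μ := by
        refine lintegral_mono fun y => ?_
        rw [← ENNReal.ofReal_add (abs_nonneg _) (abs_nonneg _), abs_sub_comm (v i y) (u y)]
        exact ENNReal.ofReal_le_ofReal (abs_sub_le _ _ _)
    _ = _ := lintegral_add_left' hm _
    _ ≤ _ := by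
        gcongr
        exact hP.lintegral_abs_sub_average_le hμ hΩ (hv i) (hg i) (by positivity) hball

end MetricBV

/-! ### Whitney balls and the discrete convolution -/

namespace MetricBV

theorem tsum_indicator_le_of_pairwiseDisjoint {X : Type*} {U : Set X} {B : X → Set X}
    (hU : U.PairwiseDisjoint B) (y : X) (b : ℝ≥0∞) :
    ∑' x : U, (B x).indicator (fun _ => b) y ≤ b := by
  by_cases h : ∃ x : U, y ∈ B x
  · obtain ⟨x, hx⟩ := h
    rw [tsum_eq_single x fun z hz => indicator_of_notMem (fun hy => ?_) _]
    · exact indicator_le_self' (fun _ _ => zero_le) y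
    · exact (hU z.2 x.2 fun h => hz (Subtype.ext h)).le_bot ⟨hy, hx⟩
  · push Not at h
    simp [indicator_of_notMem (h _)]

variable {X : Type*} [MetricSpace X] {ι : Type*}

section Whitney

variable {Ω : Set X} {lam R : ℝ} {C0 : ℕ} {c : ι → X} {r : ι → ℝ}

theorem IsWhitneyCovering.closedBall_subset [MeasurableSpace X]
    (hW : IsWhitneyCovering Ω lam R C0 c r) (hlam : 1 ≤ lam) (k : ι) :
    closedBall (c k) (lam * (2 * r k)) ⊆ Ω := by
  intro z hz
  by_contra hzΩ
  have hr := hW.radius_pos k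
  have h1 := hW.le_dist k (c k) (mem_ball_self (by positivity)) z hzΩ
  rw [mem_closedBall'] at hz
  have : 0 < lam * r k := by positivity
  linarith

theorem IsWhitneyCovering.encard_setOf_mem_ball_le [MeasurableSpace X]
    (hW : IsWhitneyCovering Ω lam R C0 c r) (y : X) :
    {k | y ∈ ball (c k) (5 * lam * r k)}.encard ≤ C0 := by
  rcases eq_empty_or_nonempty {k | y ∈ ball (c k) (5 * lam * r k)} with h | ⟨k, hk⟩
  · rw [h, encard_empty]
    exact zero_le
  · refine le_trans (encard_le_encard ?_) (hW.overlap k)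
    exact fun j hj => ⟨y, hj, hk⟩

/-- After exchanging sum and integral, each point is counted at most `C0` times, because `2λB_k ⊆
5λB_k`. -/
theorem IsWhitneyCovering.tsum_setLIntegral_le [MeasurableSpace X] [BorelSpace X] [Countable ι]
    (hW : IsWhitneyCovering Ω lam R C0 c r) (hlam : 1 ≤ lam) (hΩ : IsOpen Ω) (μ : Measure X)
    {g : X → ℝ≥0∞} (hg : Measurable g) :
    ∑' k, ∫⁻ y in ball (c k) (lam * (2 * r k)), g y ∂μ ≤ C0 * ∫⁻ y in Ω, g y ∂μ := by
  simp only [← lintegral_indicator measurableSet_ball, ← lintegral_indicator hΩ.measurableSet]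
  rw [← lintegral_tsum fun k => (hg.indicator measurableSet_ball).aemeasurable,
    ← lintegral_const_mul _ (hg.indicator hΩ.measurableSet)]
  refine lintegral_mono fun y => ?_
  by_cases hy : y ∈ Ω
  · rw [indicator_of_mem hy]
    have hsum : ∑' k, (ball (c k) (lam * (2 * r k))).indicator g y =
        ∑' k, {k | y ∈ ball (c k) (lam * (2 * r k))}.indicator (fun _ => g y) k := by
      exact tsum_congr fun k => rfl
    rw [hsum, ← tsum_subtype, ENNReal.tsum_set_const]
    gcongr
    have hle : {k | y ∈ ball (c k) (lam * (2 * r k))}.encard ≤ C0 := by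
      refine (encard_le_encard fun k hk => ?_).trans (hW.encard_setOf_mem_ball_le y)
      refine ball_subset_ball ?_ hk
      have : 0 < lam * r k := mul_pos (by linarith) (hW.radius_pos k)
      linarith
    simpa using ENat.toENNReal_le.2 hle
  · have hz : ∀ k, (ball (c k) (lam * (2 * r k))).indicator g y = 0 := fun k =>
      indicator_of_notMem
        (fun h => hy (hW.closedBall_subset hlam k (ball_subset_closedBall h))) g
    simp [hz]

/-- Fatou's lemma for sums. -/
theorem tsum_liminf_le_liminf_tsum (f : ℕ → ι → ℝ≥0∞) :
    ∑' k, liminf (fun i => f i k) atTop ≤ liminf (fun i => ∑' k, f i k) atTop := by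
  let _ : MeasurableSpace ι := ⊤
  have h := lintegral_liminf_le (μ := Measure.count) (u := atTop) (f := f)
    fun _ => measurable_from_top
  simpa only [lintegral_count] using h

variable [MeasurableSpace X] {μ : Measure X} {L : ℝ≥0} {φ : ι → X → ℝ}

/-- Since `∑ φ_k = 1`, `u_W - u = ∑ (u_{B_k} - u) φ_k`, where `φ_k ≤ 1` vanishes outside `2B_k`. -/
theorem IsWhitneyPartition.abs_discreteConvolution_sub_le (hlam : 1 ≤ lam)
    (hW : IsWhitneyCovering Ω lam R C0 c r) (hφ : IsWhitneyPartition Ω c r L φ) (u : X → ℝ)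
    {y : X} (hy : y ∈ Ω) :
    ENNReal.ofReal |discreteConvolution μ c r φ u y - u y| ≤
      ∑' k, (ball (c k) (2 * r k)).indicator
        (fun z => ENNReal.ofReal |u z - ⨍ w in ball (c k) (r k), u w ∂μ|) y := by
  have hzero : ∀ k, y ∉ ball (c k) (2 * r k) → φ k y = 0 := fun k hk => by
    by_contra h
    exact hk (hφ.support_subset k h)
  have hfin : {k | y ∈ ball (c k) (5 * lam * r k)}.Finite :=
    finite_of_encard_le_coe (hW.encard_setOf_mem_ball_le y)
  -- Without summability the `tsum` defining `u_W` would default to `0`; here only finitely many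
  -- terms are nonzero.
  have hsum : Summable fun k => (⨍ w in ball (c k) (r k), u w ∂μ) * φ k y := by
    refine summable_of_hasFiniteSupport (hfin.subset fun k hk => ?_)
    by_contra hk'
    have hle : 2 * r k ≤ 5 * lam * r k := by
      have := hW.radius_pos k
      nlinarith
    refine hk ?_
    dsimp only
    rw [hzero k fun h => hk' (ball_subset_ball hle h), mul_zero]
  have hone := (hφ.hasSum_one y hy).mul_left (u y)
  rw [mul_one] at hone
  have heq : discreteConvolution μ c r φ u y - u y =
      ∑' k, ((⨍ w in ball (c k) (r k), u w ∂μ) * φ k y - u y * φ k y) :=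
    (hsum.hasSum.sub hone).tsum_eq.symm
  rw [← Real.enorm_eq_ofReal_abs, heq]
  refine enorm_tsum_le_tsum_enorm.trans (ENNReal.tsum_le_tsum fun k => ?_)
  by_cases hk : y ∈ ball (c k) (2 * r k)
  · rw [indicator_of_mem hk, ← sub_mul, Real.enorm_eq_ofReal_abs, abs_mul, abs_sub_comm,
      abs_of_nonneg (hφ.nonneg k y)]
    exact ENNReal.ofReal_le_ofReal (mul_le_of_le_one_right (abs_nonneg _) (hφ.le_one k y))
  · simp [hzero k hk]

/-- Near a point outside `Ω`, the distance between `u` and its discrete convolution is controlled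
by the oscillations of `u` on the nearby Whitney balls. -/
theorem IsWhitneyPartition.setLIntegral_abs_discreteConvolution_sub_le [BorelSpace X] [Countable ι]
    (hlam : 1 ≤ lam) (hW : IsWhitneyCovering Ω lam R C0 c r) (hφ : IsWhitneyPartition Ω c r L φ)
    (hΩ : IsOpen Ω) {u : X → ℝ} (hu : IntegrableOn u Ω μ) {K : ℝ≥0∞} {a : ι → ℝ≥0∞}
    (ha : ∀ k, ∫⁻ y in ball (c k) (2 * r k),
      ENNReal.ofReal |u y - ⨍ w in ball (c k) (r k), u w ∂μ| ∂μ ≤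
        K * (ENNReal.ofReal (r k) * a k)) {x : X} (hx : x ∉ Ω) (s : ℝ) :
    ∫⁻ y in ball x s ∩ Ω, ENNReal.ofReal |discreteConvolution μ c r φ u y - u y| ∂μ ≤
      K * (ENNReal.ofReal s * ∑' k, (c ⁻¹' ball x (2 * s)).indicator a k) := by
  have hS : MeasurableSet (ball x s ∩ Ω) := measurableSet_ball.inter hΩ.measurableSet
  have hum : AEMeasurable u (μ.restrict (ball x s ∩ Ω)) :=
    (hu.mono_set inter_subset_right).aemeasurable
  calc ∫⁻ y in ball x s ∩ Ω, ENNReal.ofReal |discreteConvolution μ c r φ u y - u y| ∂μ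
      ≤ ∫⁻ y in ball x s ∩ Ω, ∑' k, (ball (c k) (2 * r k)).indicator
          (fun z => ENNReal.ofReal |u z - ⨍ w in ball (c k) (r k), u w ∂μ|) y ∂μ :=
        setLIntegral_mono' hS fun y hy => hφ.abs_discreteConvolution_sub_le hlam hW u hy.2
    _ = ∑' k, ∫⁻ y in ball x s ∩ Ω, (ball (c k) (2 * r k)).indicator
          (fun z => ENNReal.ofReal |u z - ⨍ w in ball (c k) (r k), u w ∂μ|) y ∂μ := by
        refine lintegral_tsum fun k => AEMeasurable.indicator ?_ measurableSet_ball
        simp only [← Real.enorm_eq_ofReal_abs]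
        exact (hum.sub_const _).enorm
    _ ≤ ∑' k, K * (ENNReal.ofReal s * (c ⁻¹' ball x (2 * s)).indicator a k) := by
        refine ENNReal.tsum_le_tsum fun k => ?_
        rw [setLIntegral_indicator measurableSet_ball]
        rcases eq_empty_or_nonempty (ball (c k) (2 * r k) ∩ (ball x s ∩ Ω)) with h | ⟨y, hy⟩
        · simp [h]
        -- From `18 λ r_k ≤ dist y x < s` follow `r_k ≤ s` and `dist (c k) x < 2 r_k + s ≤ 2s`.
        · have h1 := hW.le_dist k y hy.1 x hx
          have h2 : dist y x < s := hy.2.1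
          have h3 : dist y (c k) < 2 * r k := hy.1
          have hr := hW.radius_pos k
          have hrs : 18 * r k ≤ s := by nlinarith
          have hck : k ∈ c ⁻¹' ball x (2 * s) := by
            rw [mem_preimage, mem_ball]
            have := dist_triangle_left (c k) x y
            linarith
          rw [indicator_of_mem hck]
          refine (lintegral_mono_set inter_subset_left).trans ((ha k).trans ?_)
          gcongr
          linarith
    _ = _ := by rw [ENNReal.tsum_mul_left, ENNReal.tsum_mul_left]

end Whitney

/-! ### Codimension one density outside `Ω` -/

section Density

variable [MeasurableSpace X] {μ : Measure X}

theorem hausdorffContent_mono {R : ℝ} {A B : Set X} (h : A ⊆ B) :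
    hausdorffContent μ R A ≤ hausdorffContent μ R B :=
  iInf_mono fun _ => iInf_mono fun _ => iInf_mono fun _ =>
    le_iInf fun hB => iInf_le_of_le (h.trans hB) le_rfl

theorem hausdorffContent_le {R : ℝ} {A : Set X} {S : Set (X × ℝ)} (hS : S.Countable)
    (hR : ∀ p ∈ S, 0 < p.2 ∧ p.2 ≤ R) (hA : A ⊆ ⋃ p ∈ S, ball p.1 p.2) :
    hausdorffContent μ R A ≤ ∑' p : S, μ (ball p.1.1 p.1.2) / ENNReal.ofReal p.1.2 :=
  iInf_le_of_le S (iInf_le_of_le hS (iInf_le_of_le hR (iInf_le_of_le hA le_rfl)))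

theorem hausdorffContent_iUnion_eq_zero {R : ℝ} {A : ℕ → Set X}
    (h : ∀ n, hausdorffContent μ R (A n) = 0) : hausdorffContent μ R (⋃ n, A n) = 0 := by
  refine nonpos_iff_eq_zero.1 (ENNReal.le_of_forall_pos_le_add fun ε hε _ => ?_)
  obtain ⟨ε', hε', hsum⟩ := ENNReal.exists_pos_sum_of_countable' (ENNReal.coe_pos.2 hε).ne' ℕ
  have hex : ∀ n, ∃ S : Set (X × ℝ), S.Countable ∧ (∀ p ∈ S, 0 < p.2 ∧ p.2 ≤ R) ∧
      (A n ⊆ ⋃ p ∈ S, ball p.1 p.2) ∧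
      ∑' p : S, μ (ball p.1.1 p.1.2) / ENNReal.ofReal p.1.2 < ε' n := fun n => by
    have hn : hausdorffContent μ R (A n) < ε' n := (h n).trans_lt (hε' n)
    simp only [hausdorffContent, iInf_lt_iff, exists_prop] at hn
    exact hn
  choose S hS hSR hA hlt using hex
  rw [zero_add]
  refine (hausdorffContent_le (S := ⋃ n, S n) (countable_iUnion hS) ?_ ?_).trans ?_
  · rintro p hp
    obtain ⟨n, hn⟩ := mem_iUnion.1 hp
    exact hSR n p hn
  · refine iUnion_subset fun n => (hA n).trans ?_
    exact biUnion_subset_biUnion_left (subset_iUnion S n)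
  · refine (ENNReal.tsum_iUnion_le_tsum
      (fun p : X × ℝ => μ (ball p.1 p.2) / ENNReal.ofReal p.2) S).trans ?_
    exact (ENNReal.tsum_le_tsum fun n => (hlt n).le).trans hsum.le

/-- The codimension one upper density of a finite discrete measure carried by an open set `Ω`
is smaller than `ε` outside of `Ω`, except for a set of zero content. -/
theorem IsDoubling.hausdorffContent_setOf_frequently_eq_zero [BorelSpace X]
    [SecondCountableTopology X] {Cd : ℝ≥0} (hμ : IsDoubling μ Cd) {Ω : Set X} (hΩ : IsOpen Ω)
    {c : ι → X} (hc : ∀ k, c k ∈ Ω) {a : ι → ℝ≥0∞} (ha : ∑' k, a k ≠ ∞) {ε : ℝ≥0∞} (hε : ε ≠ 0)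
    (hε' : ε ≠ ∞) {R : ℝ} (hR : 0 < R) :
    hausdorffContent μ R {x ∈ Ωᶜ | ∃ᶠ s in 𝓝[>] (0 : ℝ), ε < (μ (ball x s))⁻¹ *
      (ENNReal.ofReal s * ∑' k, (c ⁻¹' ball x (2 * s)).indicator a k)} = 0 := by
  set E := {x ∈ Ωᶜ | ∃ᶠ s in 𝓝[>] (0 : ℝ), ε < (μ (ball x s))⁻¹ *
      (ENNReal.ofReal s * ∑' k, (c ⁻¹' ball x (2 * s)).indicator a k)} with hE
  -- It suffices to bound the content, for every finite `T`, by `Cd ^ 3 * ε⁻¹` times the mass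
  -- outside `T`.
  have hlim := ENNReal.Tendsto.const_mul (a := (Cd : ℝ≥0∞) ^ 3 * ε⁻¹)
    (ENNReal.tendsto_tsum_compl_atTop_zero ha) (Or.inr (by finiteness))
  rw [mul_zero] at hlim
  refine nonpos_iff_eq_zero.1 (ge_of_tendsto' hlim fun T => ?_)
  -- For such `δ`, balls of radius at most `2δ` centred outside `Ω` miss all centres indexed by `T`,
  -- and the covering radii `8s` are admissible.
  have hδ : ∀ᶠ δ in 𝓝[>] (0 : ℝ), (∀ k ∈ T, ball (c k) (2 * δ) ⊆ Ω) ∧ 8 * δ ≤ R := by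
    refine Eventually.and ((Filter.eventually_all_finset T).2 fun k _ => ?_) ?_
    · obtain ⟨ρ, hρ, hsub⟩ := Metric.isOpen_iff.1 hΩ (c k) (hc k)
      filter_upwards [Ioo_mem_nhdsGT (half_pos hρ)] with δ hδ
      exact (ball_subset_ball (by linarith [hδ.2])).trans hsub
    · filter_upwards [Ioo_mem_nhdsGT (show (0 : ℝ) < R / 8 by positivity)] with δ hδ
      linarith [hδ.2]
  obtain ⟨δ, ⟨hδT, hδR⟩, hδ0⟩ := (hδ.and self_mem_nhdsWithin).exists
  replace hδ0 : 0 < δ := hδ0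
  have hex : ∀ x ∈ E, ∃ s : ℝ, (0 < s ∧ s < δ) ∧ ε < (μ (ball x s))⁻¹ *
      (ENNReal.ofReal s * ∑' k, (c ⁻¹' ball x (2 * s)).indicator a k) := fun x hx => by
    obtain ⟨s, hs, hs'⟩ := (hx.2.and_eventually (Ioo_mem_nhdsGT hδ0)).exists
    exact ⟨s, hs', hs⟩
  choose! s hs hsE using hex
  -- The balls `B(x,2s)` are the ones whose mass is counted, so these are made disjoint. Their
  -- 4-fold enlargements have radius `8s = 2 ^ 3 * s`, whence `Cd ^ 3`.
  obtain ⟨U, hUE, hdisj, hcov⟩ := Vitali.exists_disjoint_subfamily_covering_enlargement_ball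
    E (fun x : X => x) (fun x => 2 * s x) (2 * δ) (fun x hx => by linarith [(hs x hx).2]) 4
    (by norm_num)
  have hUc : U.Countable := hdisj.countable_of_isOpen (fun _ _ => isOpen_ball) fun x hx =>
    ⟨x, mem_ball_self (by linarith [(hs x (hUE hx)).1])⟩
  calc hausdorffContent μ R E
      ≤ ∑' p : (fun x => (x, 8 * s x)) '' U, μ (ball p.1.1 p.1.2) / ENNReal.ofReal p.1.2 := by
        refine hausdorffContent_le (hUc.image _) ?_ fun x hx => ?_
        · rintro _ ⟨x, hx, rfl⟩
          have := hs x (hUE hx)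
          constructor <;> dsimp only <;> linarith
        · obtain ⟨z, hz, hsub⟩ := hcov x hx
          rw [biUnion_image]
          refine mem_iUnion₂.2 ⟨z, hz, ?_⟩
          have h := hsub (mem_ball_self (by linarith [(hs x hx).1]))
          rwa [← mul_assoc, show (4 : ℝ) * 2 = 8 by norm_num] at h
    _ = ∑' x : U, μ (ball (x : X) (8 * s x)) / ENNReal.ofReal (8 * s x) :=
        tsum_image (fun p : X × ℝ => μ (ball p.1 p.2) / ENNReal.ofReal p.2)
          (fun x _ y _ h => congrArg Prod.fst h)
    _ ≤ ∑' x : U, (Cd : ℝ≥0∞) ^ 3 * ε⁻¹ *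
          ∑' k, (c ⁻¹' ball (x : X) (2 * s x)).indicator a k := by
        refine ENNReal.tsum_le_tsum fun ⟨x, hx⟩ => ?_
        dsimp only
        have hx' := hUE hx
        have hs0 := (hs x hx').1
        set N := ∑' k, (c ⁻¹' ball x (2 * s x)).indicator a k
        have hB0 := (hμ.measure_ball_pos x hs0).ne'
        have hBt := (hμ.measure_ball_lt_top x (s x)).ne
        have h1 : μ (ball x (s x)) ≤ ε⁻¹ * (ENNReal.ofReal (s x) * N) := by
          have h := (hsE x hx').le
          rw [mul_comm, ← div_eq_mul_inv, ENNReal.le_div_iff_mul_le (Or.inl hB0) (Or.inl hBt)] at h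
          rw [mul_comm ε⁻¹, ← div_eq_mul_inv, ENNReal.le_div_iff_mul_le (Or.inl hε) (Or.inl hε'),
            mul_comm]
          exact h
        have h2 := hμ.measure_ball_two_pow_le x hs0 3
        rw [show (2 : ℝ) ^ 3 = 8 by norm_num] at h2
        refine ENNReal.div_le_of_le_mul ?_
        calc μ (ball x (8 * s x)) ≤ (Cd : ℝ≥0∞) ^ 3 * (ε⁻¹ * (ENNReal.ofReal (s x) * N)) := by
              refine h2.trans ?_
              gcongr
          _ ≤ (Cd : ℝ≥0∞) ^ 3 * (ε⁻¹ * (ENNReal.ofReal (8 * s x) * N)) := by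
              gcongr
              linarith
          _ = _ := by ring
    _ = (Cd : ℝ≥0∞) ^ 3 * ε⁻¹ *
          ∑' k, ∑' x : U, (c ⁻¹' ball (x : X) (2 * s x)).indicator a k := by
        rw [ENNReal.tsum_mul_left, ENNReal.tsum_comm]
    -- Masses in `T` are never counted, and the others at most once by disjointness.
    _ ≤ (Cd : ℝ≥0∞) ^ 3 * ε⁻¹ * ∑' k, {k | k ∉ T}.indicator a k := by
        gcongr with k
        by_cases hk : k ∈ T
        · refine le_of_eq_of_le ?_ zero_le
          refine ENNReal.tsum_eq_zero.2 fun x => indicator_of_notMem (fun hx => ?_) _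
          refine (hUE x.2).1 (hδT k hk ?_)
          rw [mem_preimage, mem_ball'] at hx
          exact mem_ball.2 (hx.trans (by linarith [(hs x (hUE x.2)).2]))
        · rw [indicator_of_mem (show k ∈ {k | k ∉ T} from hk)]
          exact tsum_indicator_le_of_pairwiseDisjoint hdisj (c k) (a k)
    _ = _ := by rw [← tsum_subtype]; rfl

/-- The codimension one density of a finite discrete measure carried by an open set `Ω` vanishes
at almost every point outside of `Ω`. -/
theorem IsDoubling.hausdorffCodimOne_setOf_not_tendsto_eq_zero [BorelSpace X]
    [SecondCountableTopology X] {Cd : ℝ≥0} (hμ : IsDoubling μ Cd) {Ω : Set X} (hΩ : IsOpen Ω)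
    {c : ι → X} (hc : ∀ k, c k ∈ Ω) {a : ι → ℝ≥0∞} (ha : ∑' k, a k ≠ ∞) :
    hausdorffCodimOne μ {x ∈ Ωᶜ | ¬ Tendsto (fun s : ℝ => (μ (ball x s))⁻¹ *
      (ENNReal.ofReal s * ∑' k, (c ⁻¹' ball x (2 * s)).indicator a k)) (𝓝[>] 0) (𝓝 0)} = 0 := by
  refine nonpos_iff_eq_zero.1 (iSup₂_le fun R hR => ?_)
  -- The shift in `(n + 1)⁻¹` keeps the threshold finite at `n = 0`.
  refine (hausdorffContent_mono (B := ⋃ n : ℕ, {x ∈ Ωᶜ | ∃ᶠ s in 𝓝[>] (0 : ℝ),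
    ((n : ℝ≥0∞) + 1)⁻¹ < (μ (ball x s))⁻¹ *
      (ENNReal.ofReal s * ∑' k, (c ⁻¹' ball x (2 * s)).indicator a k)}) ?_).trans ?_
  · rintro x ⟨hx, hnot⟩
    rw [ENNReal.tendsto_nhds_zero] at hnot
    push Not at hnot
    obtain ⟨ε, hε, hfreq⟩ := hnot
    obtain ⟨n, hn⟩ := ENNReal.exists_inv_nat_lt hε.ne'
    refine mem_iUnion.2 ⟨n, hx, hfreq.mono fun s hs => lt_of_le_of_lt ?_ hs⟩
    exact (ENNReal.inv_le_inv.2 le_self_add).trans hn.le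
  · refine (hausdorffContent_iUnion_eq_zero fun n => ?_).le
    exact hμ.hausdorffContent_setOf_frequently_eq_zero hΩ hc ha
      (ENNReal.inv_ne_zero.2 (by finiteness)) (ENNReal.inv_ne_top.2 (by simp)) hR

theorem hausdorffCodimOne_mono {A B : Set X} (h : A ⊆ B) :
    hausdorffCodimOne μ A ≤ hausdorffCodimOne μ B :=
  iSup₂_mono fun _ _ => hausdorffContent_mono h

end Density

end MetricBV

end

/-! ### Conclusion -/

theorem mainTheorem9 {X : Type*} [MetricSpace X] [CompleteSpace X] [MeasurableSpace X]
    [BorelSpace X] (μ : Measure X) (Cd : ℝ≥0) (hμ : MetricBV.IsDoubling μ Cd)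
    (CP lam : ℝ) (hP : MetricBV.SupportsPoincare μ CP lam)
    (Ω : Set X) (hΩ : IsOpen Ω) (R : ℝ) (hR : 0 < R)
    (u : X → ℝ) (hu : MetricBV.IsBV μ Ω u)
    {ι : Type*} [Countable ι] (C0 : ℕ) (c : ι → X) (r : ι → ℝ)
    (hW : MetricBV.IsWhitneyCovering Ω lam R C0 c r)
    (L : ℝ≥0) (φ : ι → X → ℝ) (hφ : MetricBV.IsWhitneyPartition Ω c r L φ) :
    MetricBV.hausdorffCodimOne μ
      {x ∈ frontier Ω | ¬ Tendsto
        (fun s : ℝ => (μ (ball x s))⁻¹ *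
          ∫⁻ y in ball x s ∩ Ω,
            ENNReal.ofReal |MetricBV.discreteConvolution μ c r φ u y - u y| ∂μ)
        (𝓝[>] 0) (𝓝 0)} = 0 := by
  have := hμ.properSpace
  have hlam := hP.2.1
  obtain ⟨huint, hvar⟩ := hu
  simp only [MetricBV.totalVariation, iInf_lt_iff] at hvar
  obtain ⟨v, g, hv, hg, hvu, hlt⟩ := hvar
  set a : ι → ℝ≥0∞ := fun k =>
    liminf (fun i => ∫⁻ y in ball (c k) (lam * (2 * r k)), g i y ∂μ) atTop with ha_def
  -- All `a k` come from one sequence, so Fatou for sums moves the lower limit outside before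
  -- bounded overlap is applied.
  have ha : ∑' k, a k ≠ ∞ := by
    refine ne_top_of_le_ne_top ?_ ((MetricBV.tsum_liminf_le_liminf_tsum _).trans
      (liminf_le_liminf (Eventually.of_forall fun i =>
        hW.tsum_setLIntegral_le hlam hΩ μ (hg i).1)))
    rw [ENNReal.liminf_const_mul_of_ne_top (by finiteness)]
    exact ENNReal.mul_ne_top (by finiteness) hlt.ne
  set K : ℝ≥0∞ := (1 + Cd) * ENNReal.ofReal (CP * 2) with hK
  have hosc : ∀ k, ∫⁻ y in ball (c k) (2 * r k),
      ENNReal.ofReal |u y - ⨍ w in ball (c k) (r k), u w ∂μ| ∂μ ≤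
        K * (ENNReal.ofReal (r k) * a k) := fun k => by
    refine (hP.lintegral_abs_sub_average_half_le_liminf hμ hΩ huint hv hg hvu (hW.radius_pos k)
      (hW.closedBall_subset hlam k)).trans_eq ?_
    rw [← mul_assoc CP, ENNReal.ofReal_mul (by linarith [hP.1])]
    ring
  refine nonpos_iff_eq_zero.1 ((MetricBV.hausdorffCodimOne_mono ?_).trans
    (hμ.hausdorffCodimOne_setOf_not_tendsto_eq_zero hΩ hW.center_mem ha).le)
  rintro x ⟨hx, hnot⟩
  have hxΩ : x ∉ Ω := by
    rw [hΩ.frontier_eq] at hx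
    exact hx.2
  refine ⟨hxΩ, fun htend => hnot ?_⟩
  have hlim := ENNReal.Tendsto.const_mul (a := K) htend (Or.inr (by finiteness))
  rw [mul_zero] at hlim
  refine tendsto_of_tendsto_of_tendsto_of_le_of_le tendsto_const_nhds hlim (fun _ => zero_le)
    fun s => ?_
  dsimp only
  rw [mul_left_comm K]
  gcongr
  exact hφ.setLIntegral_abs_discreteConvolution_sub_le hlam hW hΩ huint hosc hxΩ s
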